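/- Let $d\ge 1$. For $f,g\in L^2(\mathbb R^d)$ let $V_gf(x,\xi)=\int_{\mathbb R^d} f(t)\overline{g(t-x)}e^{-2\pi i\xi\cdot t}\,dt$, $z=(x,\xi)\in\mathbb R^{2d}$, be the short-time Fourier transform. Let $g\in L^2(\mathbb R^d)$ satisfy $\|g\|_2=1$ and $$\|g\|_{M^*}^2:=\int_{\mathbb R^{2d}}|z|\,|V_gg(z)|^2\,dz<\infty ,$$ and let $\Omega\subset\mathbb R^{2d}$ be a compact set of positive Lebesgue measure $|\Omega|$ and of finite perimeter $$|\partial\Omega|:=\sup\Big\{\int_\Omega \operatorname{div}\phi\,dz:\ \phi\in C^1_c(\mathbb R^{2d},\mathbb R^{2d}),\ |\phi(z)|\le 1 \text{ for all } z\Big\}<\infty .$$ Let $H_\Omega f=\int_\Omega V_gf(x,\xi)\,g(\cdot-x)e^{2\pi i\xi\cdot(\cdot)}\,dx\,d\xi$ be the time-frequency localization operator on $L^2(\mathbb R^d)$. It can be diagonalized as $H_\Omega f=\sum_{k\ge1}\lambda_k\langle f,h_k\rangle h_k$ for all $f\in L^2(\mathbb R^d)$, where $(\lambda_k)_{k\ge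 1}$ is the finite or infinite list of the non-zero eigenvalues of $H_\Omega$, repeated according to multiplicity and ordered non-increasingly, and $(h_k)_{k\ge 1}$ is a corresponding orthonormal system of eigenfunctions. For every such choice of $(\lambda_k)$ and $(h_k)$, there are at least $A_\Omega:=\lceil|\Omega|\rceil$ eigenfunctions in the list, and the accumulated spectrogram $\rho_\Omega:=\sum_{k=1}^{A_\Omega}|V_gh_k|^2$ satisfies $\rho_\Omega-1_\Omega*|V_gg|^2\in L^1(\mathbb R^{2d})$ and $$\frac1{|\Omega|}\big\|\rho_\Omega-1_\Omega*|V_gg|^2\big\|_1\le\frac1{|\Omega|}+4\,\|g\|_{M^*}\sqrt{\frac{|\partial\Omega|}{|\Omega|}} .$$ -/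

import Mathlib

open MeasureTheory Complex
open scoped ENNReal ComplexConjugate InnerProductSpace Convolution

noncomputable section

namespace AccSpec

/-- `L²(ℝᵈ)` with complex values. -/
abbrev L2 (d : ℕ) : Type :=
  Lp ℂ 2 (volume : Measure (EuclideanSpace ℝ (Fin d)))

/-- The time-frequency plane `ℝ²ᵈ = ℝᵈ × ℝᵈ` of points `z = (x, ξ)`, with its Euclidean norm
`|z| = √(|x|² + |ξ|²)` and Lebesgue measure. -/
abbrev Phase (d : ℕ) : Type :=
  WithLp 2 (EuclideanSpace ℝ (Fin d) × EuclideanSpace ℝ (Fin d))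

/-- The short-time Fourier transform
`V_g f (x, ξ) = ∫ f(t) conj(g(t - x)) exp(-2πi ξ·t) dt`. -/
def stft {d : ℕ} (g f : L2 d) (z : Phase d) : ℂ :=
  ∫ t : EuclideanSpace ℝ (Fin d),
    f t * conj (g (t - z.fst)) * cexp (-(2 * Real.pi * I * (⟪z.snd, t⟫_ℝ : ℝ)))

theorem memLp_tfShift {d : ℕ} (g : L2 d) (z : Phase d) :
    MemLp (fun t : EuclideanSpace ℝ (Fin d) =>
      cexp (2 * Real.pi * I * (⟪z.snd, t⟫_ℝ : ℝ)) * g (t - z.fst)) 2 volume := by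
  have h1 : MemLp (fun t : EuclideanSpace ℝ (Fin d) => g (t - z.fst)) 2 volume :=
    (Lp.memLp g).comp_measurePreserving (measurePreserving_sub_right volume z.fst)
  have hc : Continuous (fun t : EuclideanSpace ℝ (Fin d) =>
      cexp (2 * Real.pi * I * (⟪z.snd, t⟫_ℝ : ℝ))) := by fun_prop
  refine h1.of_le (hc.aestronglyMeasurable.mul h1.aestronglyMeasurable)
    (Filter.Eventually.of_forall fun t => ?_)
  have h2 : ‖cexp (2 * Real.pi * I * (⟪z.snd, t⟫_ℝ : ℝ))‖ = 1 := by
    rw [show (2 * Real.pi * I * (⟪z.snd, t⟫_ℝ : ℝ) : ℂ)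
      = ((2 * Real.pi * ⟪z.snd, t⟫_ℝ : ℝ) : ℂ) * I by push_cast; ring]
    exact Complex.norm_exp_ofReal_mul_I _
  rw [norm_mul, h2, one_mul]

/-- The time-frequency shift `t ↦ g(t - x) exp(2πi ξ·t)` of `g` by `z = (x, ξ)`,
as an element of `L²(ℝᵈ)`. -/
def tfShift {d : ℕ} (g : L2 d) (z : Phase d) : L2 d :=
  (memLp_tfShift g z).toLp _

/-- The time-frequency localization operator
`H_Ω f = ∫_Ω V_g f(x, ξ) g(· - x) exp(2πi ξ·) dx dξ`, an `L²(ℝᵈ)`-valued integral. -/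
def locOp {d : ℕ} (g : L2 d) (Ω : Set (Phase d)) (f : L2 d) : L2 d :=
  ∫ z in Ω, stft g f z • tfShift g z

/-- `(lam k, h k)`, `k < N` (with `N ≤ ∞`, counting from `0`), is a listing of the non-zero
eigenvalues of `H_Ω` in non-increasing order, repeated according to multiplicity, with a
corresponding orthonormal system of eigenfunctions, so that
`H_Ω f = ∑_k lam k ⟨f, h k⟩ h k` for all `f ∈ L²(ℝᵈ)`.
The values of `lam k` and `h k` for `k ≥ N` are irrelevant. -/
structure IsEigensystem {d : ℕ} (g : L2 d) (Ω : Set (Phase d))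
    (N : ℕ∞) (lam : ℕ → ℝ) (h : ℕ → L2 d) : Prop where
  orthonormal : Orthonormal ℂ (fun k : {k : ℕ // (k : ℕ∞) < N} => h k)
  ne_zero : ∀ k : ℕ, (k : ℕ∞) < N → lam k ≠ 0
  eigen : ∀ k : ℕ, (k : ℕ∞) < N → locOp g Ω (h k) = (lam k : ℂ) • h k
  antitone : AntitoneOn lam {k : ℕ | (k : ℕ∞) < N}
  diagonal : ∀ f : L2 d,
    HasSum (fun k : {k : ℕ // (k : ℕ∞) < N} => ((lam k : ℂ) * ⟪h k, f⟫_ℂ) • h k)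
      (locOp g Ω f)

/-- `A_Ω = ⌈|Ω|⌉`. -/
def numEig {d : ℕ} (Ω : Set (Phase d)) : ℕ :=
  ⌈volume.real Ω⌉₊

/-- The accumulated spectrogram `ρ_Ω = ∑_{k=1}^{A_Ω} |V_g h_k|²`
(the eigenfunctions are numbered from `0` here). -/
def accSpec {d : ℕ} (g : L2 d) (Ω : Set (Phase d)) (h : ℕ → L2 d) (z : Phase d) : ℝ :=
  ∑ k ∈ Finset.range (numEig Ω), ‖stft g (h k) z‖ ^ 2

/-- `g ∈ M*(ℝᵈ)`: the integral `∫ |z| |V_g g(z)|² dz` is finite. -/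
def MemMStar {d : ℕ} (g : L2 d) : Prop :=
  Integrable (fun z : Phase d => ‖z‖ * ‖stft g g z‖ ^ 2)

/-- `‖g‖_{M*} = (∫ |z| |V_g g(z)|² dz)^{1/2}`. -/
def normMStar {d : ℕ} (g : L2 d) : ℝ :=
  √(∫ z : Phase d, ‖z‖ * ‖stft g g z‖ ^ 2)

/-- The divergence of a vector field: the trace of its derivative, `∑_i ∂_i φ_i` in any
orthonormal coordinates. -/
def divergence {E : Type*} [NormedAddCommGroup E] [InnerProductSpace ℝ E]
    (φ : E → E) (x : E) : ℝ :=
  LinearMap.trace ℝ E (fderiv ℝ φ x : E →ₗ[ℝ] E)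

/-- The variation `Var(f)`: the supremum of `∫ f div φ` over compactly supported `C¹` vector
fields `φ` with `|φ(x)| ≤ 1` for all `x`. (The truncation at `0` by `ENNReal.ofReal` does not
change the supremum, as `φ = 0` is admissible.) -/
def variation {E : Type*} [NormedAddCommGroup E] [InnerProductSpace ℝ E] [FiniteDimensional ℝ E]
    [MeasurableSpace E] [BorelSpace E] (f : E → ℝ) : ℝ≥0∞ :=
  ⨆ (φ : E → E) (_ : ContDiff ℝ 1 φ) (_ : HasCompactSupport φ) (_ : ∀ x, ‖φ x‖ ≤ 1),
    ENNReal.ofReal (∫ x, f x * divergence φ x)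

/-- The perimeter `|∂Ω| = Var(1_Ω)`. -/
def perimeter {d : ℕ} (Ω : Set (Phase d)) : ℝ≥0∞ :=
  variation (Ω.indicator (1 : Phase d → ℝ))

/-- The convolution `1_Ω * |V_g g|²`. -/
def smoothed {d : ℕ} (g : L2 d) (Ω : Set (Phase d)) : Phase d → ℝ :=
  (Ω.indicator (1 : Phase d → ℝ)) ⋆[ContinuousLinearMap.mul ℝ ℝ, volume]
    (fun z => ‖stft g g z‖ ^ 2)

end AccSpec

end

/-!
Write `ψ_z` for the time-frequency shift of `g` by `z`, so that `V_g f(z) = ⟪ψ_z, f⟫`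
(`stft_eq_inner`) and `H_Ω = ∫_Ω ψ_z ⊗ ψ_z dz` is a compact positive operator, which can be
diagonalized (`exists_isEigensystem`). With Moyal's identity `∫ |V_g f|² = ‖f‖² ‖g‖²`
(`lintegral_enorm_stft_sq`) and `|⟪ψ_z, ψ_w⟫| = |V_g g(z - w)|`, evaluation of the eigenexpansion
at `ψ_z` gives `1_Ω * |V_g g|² = ∑ λ_k |V_g h_k|²` (`IsEigensystem.hasSum_smoothed`), where every
`|V_g h_k|²` has integral `1`. Hence the `L¹` distance of the accumulated spectrogram to
`1_Ω * |V_g g|²` is at most `∑_{k ≤ A} (1 - λ_k) + ∑_{k > A} λ_k ≤ 1 + 2 S`, where `S` is the tail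
`∑_{k > A} λ_k` and the trace formula `∑ λ_k = |Ω|` has been used (`IsEigensystem.hasSum_lam`).

The tail is at most `D := ∑ λ_k (1 - λ_k)`, because the eigenvalues decrease and `A ≥ ∑ λ_k`
(`tail_le_of_antitone`). By the trace formulas for `H_Ω` and its square, `D` is
`|Ω| - ∫_Ω 1_Ω * |V_g g|² = ∫ |V_g g(t)|² |(Ω + t) \ Ω| dt`. Testing the variation of `1_Ω` against
averages of cutoff functions over segments in the direction `t` shows that
`|(Ω + t) \ Ω| ≤ |t| |∂Ω|` (`volume_translate_diff_le`), whence `D ≤ ‖g‖²_{M*} |∂Ω|`. As `S` is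
also at most `|Ω|`, it is at most the geometric mean `‖g‖_{M*} √(|∂Ω| |Ω|)`; this gives the
estimate even with `2` in place of `4`.
-/

namespace AccSpec

/-! ### The Fourier transform of integrable and square-integrable functions -/

theorem eLpNorm_two_sq {α ε : Type*} [MeasurableSpace α] [ENorm ε] {μ : Measure α} (f : α → ε) :
    eLpNorm f 2 μ ^ 2 = ∫⁻ x, ‖f x‖ₑ ^ 2 ∂μ := by
  simpa using eLpNorm_nnreal_pow_eq_lintegral (μ := μ) (f := f) (p := 2) (by norm_num)

open FourierTransform in
theorem continuous_fourier_of_integrable {E : Type*} [NormedAddCommGroup E] [InnerProductSpace ℝ E]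
    [FiniteDimensional ℝ E] [MeasurableSpace E] [BorelSpace E] {f : E → ℂ}
    (h1 : Integrable f) : Continuous (𝓕 f) :=
  VectorFourier.fourierIntegral_continuous Real.continuous_fourierChar
    (L := innerₗ E) continuous_inner h1

open FourierTransform in
/-- The Fourier integral of an integrable and square-integrable function represents its `L²` Fourier
transform: both define the same tempered distribution. -/
theorem coeFn_fourier_toLp_ae_eq {E : Type*} [NormedAddCommGroup E] [InnerProductSpace ℝ E]
    [FiniteDimensional ℝ E] [MeasurableSpace E] [BorelSpace E] {f : E → ℂ}
    (h1 : Integrable f) (h2 : MemLp f 2) :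
    (𝓕 (h2.toLp f) : Lp (α := E) ℂ 2) =ᵐ[volume] 𝓕 f := by
  refine ae_eq_of_integral_contDiff_smul_eq (Lp.memLp _ |>.locallyIntegrable (by norm_num))
    (continuous_fourier_of_integrable h1).locallyIntegrable ?_
  intro φ hφ hφc
  have hg₁ : HasCompactSupport (ofRealCLM ∘ φ) := hφc.comp_left rfl
  have hg₂ : ContDiff ℝ ((⊤ : ℕ∞) : WithTop ℕ∞) (ofRealCLM ∘ φ) := by fun_prop
  set Φ := hg₁.toSchwartzMap hg₂ with hΦ
  have key := VectorFourier.integral_fourierIntegral_smul_eq_flip (L := innerₗ E)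
    Real.continuous_fourierChar continuous_inner (Φ.integrable (μ := volume)) h1
  rw [flip_innerₗ] at key
  have e : ∀ u : E → ℂ, ∫ x, φ x • u x ∂volume = ∫ x, Φ x • u x ∂volume := fun u => by
    refine integral_congr_ae (.of_forall fun x => ?_)
    simp [hΦ]
  rw [e, e]
  calc ∫ x, Φ x • (𝓕 (h2.toLp f) : Lp (α := E) ℂ 2 volume) x
      = Lp.toTemperedDistribution (μ := volume) (𝓕 (h2.toLp f) : Lp (α := E) ℂ 2 volume) Φ := by
        rw [Lp.toTemperedDistribution_apply]
    _ = ∫ x, (𝓕 Φ) x • f x := by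
        rw [← Lp.fourier_toTemperedDistribution_eq, TemperedDistribution.fourier_apply,
          Lp.toTemperedDistribution_apply]
        refine integral_congr_ae ?_
        filter_upwards [h2.coeFn_toLp] with x hx
        rw [hx]
    _ = _ := key

open FourierTransform in
/-- Plancherel's formula for the Fourier integral. -/
theorem lintegral_enorm_fourier_sq {E : Type*} [NormedAddCommGroup E] [InnerProductSpace ℝ E]
    [FiniteDimensional ℝ E] [MeasurableSpace E] [BorelSpace E] {f : E → ℂ}
    (h1 : Integrable f) (h2 : MemLp f 2) :
    ∫⁻ ξ, ‖𝓕 f ξ‖ₑ ^ 2 = ∫⁻ x, ‖f x‖ₑ ^ 2 := by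
  have h : eLpNorm (𝓕 f) 2 volume = eLpNorm f 2 volume := by
    rw [← eLpNorm_congr_ae (coeFn_fourier_toLp_ae_eq h1 h2), ← Lp.enorm_def,
      ← eLpNorm_congr_ae h2.coeFn_toLp, ← Lp.enorm_def, ← ofReal_norm, ← ofReal_norm,
      Lp.norm_fourier_eq]
  rw [← eLpNorm_two_sq, ← eLpNorm_two_sq, h]

/-! ### Time-frequency shifts and Moyal's identity -/

theorem norm_cexp_two_pi_I_mul (r : ℝ) : ‖cexp (2 * Real.pi * I * (r : ℝ))‖ = 1 := by
  rw [show (2 * Real.pi * I * (r : ℝ) : ℂ) = ((2 * Real.pi * r : ℝ) : ℂ) * I by push_cast; ring]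
  exact Complex.norm_exp_ofReal_mul_I _

theorem enorm_cexp_two_pi_I_mul (r : ℝ) : ‖cexp (2 * Real.pi * I * (r : ℝ))‖ₑ = 1 := by
  rw [← ofReal_norm, norm_cexp_two_pi_I_mul, ENNReal.ofReal_one]

theorem conj_cexp_two_pi_I_mul (r : ℝ) :
    conj (cexp (2 * Real.pi * I * (r : ℝ))) = cexp (-(2 * Real.pi * I * (r : ℝ))) := by
  rw [← Complex.exp_conj]
  simp [Complex.conj_ofNat]

variable {d : ℕ}

theorem coeFn_tfShift (g : L2 d) (z : Phase d) :
    tfShift g z =ᵐ[volume] fun t => cexp (2 * Real.pi * I * (⟪z.snd, t⟫_ℝ : ℝ)) * g (t - z.fst) :=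
  (memLp_tfShift g z).coeFn_toLp

theorem norm_tfShift (g : L2 d) (z : Phase d) : ‖tfShift g z‖ = ‖g‖ := by
  rw [tfShift, Lp.norm_toLp, Lp.norm_def]
  congr 1
  rw [← eLpNorm_comp_measurePreserving (Lp.aestronglyMeasurable g)
    (measurePreserving_sub_right volume z.fst)]
  refine eLpNorm_congr_enorm_ae (.of_forall fun t => ?_)
  rw [enorm_mul, enorm_cexp_two_pi_I_mul, one_mul, Function.comp_apply]

/-- The short-time Fourier transform collects the inner products with the time-frequency shifts of
the window. -/
theorem stft_eq_inner (g f : L2 d) (z : Phase d) : stft g f z = ⟪tfShift g z, f⟫_ℂ := by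
  rw [L2.inner_def, stft]
  refine integral_congr_ae ?_
  filter_upwards [coeFn_tfShift g z] with t ht
  rw [ht, RCLike.inner_apply, map_mul, conj_cexp_two_pi_I_mul]
  ring

/-- Covariance of the short-time Fourier transform: a time-frequency shift of the signal shifts the
transform, up to a phase factor. -/
theorem norm_inner_tfShift (g : L2 d) (z w : Phase d) :
    ‖⟪tfShift g z, tfShift g w⟫_ℂ‖ = ‖stft g g (z - w)‖ := by
  have h : stft g g (z - w) = cexp (2 * Real.pi * I * (⟪(z - w).snd, w.fst⟫_ℝ : ℝ)) *
      ⟪tfShift g z, tfShift g w⟫_ℂ := by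
    rw [L2.inner_def, stft, ← integral_sub_right_eq_self _ w.fst, ← integral_const_mul]
    refine integral_congr_ae ?_
    filter_upwards [coeFn_tfShift g z, coeFn_tfShift g w] with t hz hw
    rw [hz, hw, RCLike.inner_apply, map_mul, conj_cexp_two_pi_I_mul]
    have e1 : t - w.fst - (z - w).fst = t - z.fst := by
      rw [WithLp.sub_fst]; abel
    have e2 : cexp (-(2 * Real.pi * I * (⟪(z - w).snd, t - w.fst⟫_ℝ : ℝ))) =
        cexp (2 * Real.pi * I * (⟪(z - w).snd, w.fst⟫_ℝ : ℝ)) *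
        cexp (-(2 * Real.pi * I * (⟪z.snd, t⟫_ℝ : ℝ))) *
        cexp (2 * Real.pi * I * (⟪w.snd, t⟫_ℝ : ℝ)) := by
      rw [← Complex.exp_add, ← Complex.exp_add]
      congr 1
      rw [WithLp.sub_snd, inner_sub_left, inner_sub_left, inner_sub_right, inner_sub_right]
      push_cast
      ring
    rw [e1, e2]
    ring
  rw [h, norm_mul, norm_cexp_two_pi_I_mul, one_mul]

theorem enorm_sq_eq_lintegral (f : L2 d) : ‖f‖ₑ ^ 2 = ∫⁻ t, ‖f t‖ₑ ^ 2 := by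
  rw [Lp.enorm_def, eLpNorm_two_sq]

theorem tfShift_sub (g g' : L2 d) (z : Phase d) :
    tfShift (g - g') z = tfShift g z - tfShift g' z := by
  refine Lp.ext ?_
  have h0 : ∀ᵐ t, (g - g' : L2 d) (t - z.fst) = g (t - z.fst) - g' (t - z.fst) :=
    (measurePreserving_sub_right volume z.fst).quasiMeasurePreserving.ae (Lp.coeFn_sub g g')
  filter_upwards [coeFn_tfShift g z, coeFn_tfShift g' z, coeFn_tfShift (g - g') z, h0,
    Lp.coeFn_sub (tfShift g z) (tfShift g' z)] with t h1 h2 h3 h4 h5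
  rw [h3, h4, h5, Pi.sub_apply, h1, h2, mul_sub]

/-- Modulations act strongly continuously on `L²`, by dominated convergence. -/
theorem tendsto_norm_modulation_sub (u : L2 d) (ξ₀ : EuclideanSpace ℝ (Fin d)) :
    Filter.Tendsto (fun ξ => ‖tfShift u (WithLp.toLp 2 (0, ξ)) -
      tfShift u (WithLp.toLp 2 (0, ξ₀))‖) (nhds ξ₀) (nhds 0) := by
  let e : EuclideanSpace ℝ (Fin d) → EuclideanSpace ℝ (Fin d) → ℂ := fun ξ t =>
    cexp (2 * Real.pi * I * (⟪ξ, t⟫_ℝ : ℝ))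
  have he (t) : Continuous fun ξ => e ξ t := by fun_prop
  have he' (ξ) : Continuous (e ξ) := by fun_prop
  have hsq (ξ) : ‖tfShift u (WithLp.toLp 2 (0, ξ)) - tfShift u (WithLp.toLp 2 (0, ξ₀))‖ₑ ^ 2 =
      ∫⁻ t, ‖(e ξ t - e ξ₀ t) * u t‖ₑ ^ 2 := by
    rw [enorm_sq_eq_lintegral]
    refine lintegral_congr_ae ?_
    filter_upwards [coeFn_tfShift u (WithLp.toLp 2 (0, ξ)),
      coeFn_tfShift u (WithLp.toLp 2 (0, ξ₀)),
      Lp.coeFn_sub (tfShift u (WithLp.toLp 2 (0, ξ))) (tfShift u (WithLp.toLp 2 (0, ξ₀)))]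
      with t h1 h2 h3
    rw [h3, Pi.sub_apply, h1, h2]
    simp [e, sub_mul]
  have hum : Measurable u := (Lp.stronglyMeasurable u).measurable
  have hlim : Filter.Tendsto (fun ξ => ∫⁻ t, ‖(e ξ t - e ξ₀ t) * u t‖ₑ ^ 2) (nhds ξ₀)
      (nhds (∫⁻ t : EuclideanSpace ℝ (Fin d), 0)) := by
    refine tendsto_lintegral_filter_of_dominated_convergence (fun t => 4 * ‖u t‖ₑ ^ 2)
      (.of_forall fun ξ => ?_) (.of_forall fun ξ => .of_forall fun t => ?_) ?_
      (.of_forall fun t => ?_)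
    · have := (he' ξ).measurable
      have := (he' ξ₀).measurable
      fun_prop
    · have h2 : ‖e ξ t - e ξ₀ t‖ₑ ≤ 2 := by
        refine enorm_sub_le.trans ?_
        simp only [e]
        rw [enorm_cexp_two_pi_I_mul, enorm_cexp_two_pi_I_mul, one_add_one_eq_two]
      rw [enorm_mul, mul_pow]
      gcongr
      calc ‖e ξ t - e ξ₀ t‖ₑ ^ 2 ≤ 2 ^ 2 := by gcongr
        _ = 4 := by norm_num
    · rw [lintegral_const_mul _ (by fun_prop), ← enorm_sq_eq_lintegral]
      finiteness
    · have : Continuous fun ξ => ‖(e ξ t - e ξ₀ t) * u t‖ₑ ^ 2 := by fun_prop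
      simpa using this.tendsto ξ₀
  rw [lintegral_zero] at hlim
  have h2 := ((ENNReal.tendsto_toReal ENNReal.zero_ne_top).comp hlim).sqrt
  simp only [ENNReal.toReal_zero, Real.sqrt_zero] at h2
  refine h2.congr fun ξ => ?_
  rw [Function.comp_apply, ← hsq, ENNReal.toReal_pow, toReal_enorm, Real.sqrt_sq (norm_nonneg _)]

/-- Time-frequency shifts act strongly continuously on `L²`. -/
theorem continuous_tfShift (g : L2 d) : Continuous (tfShift g) := by
  -- A time-frequency shift is a modulation, which is isometric, after the translation `τ`.
  let τ : EuclideanSpace ℝ (Fin d) → L2 d := fun x =>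
    Lp.compMeasurePreserving (fun t => t - x) (measurePreserving_sub_right volume x) g
  have hτ : Continuous τ := by
    have hc : Continuous fun p : EuclideanSpace ℝ (Fin d) × EuclideanSpace ℝ (Fin d) =>
      p.2 - p.1 := by fun_prop
    exact Continuous.compMeasurePreservingLp (f := fun _ => g) continuous_const
      (ContinuousMap.curry ⟨_, hc⟩).continuous
      (fun x => measurePreserving_sub_right volume x) (by norm_num)
  have hψ (z : Phase d) : tfShift g z = tfShift (τ z.fst) (WithLp.toLp 2 (0, z.snd)) := by
    refine Lp.ext ?_
    have h0 : τ z.fst =ᵐ[volume] fun t => g (t - z.fst) :=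
      Lp.coeFn_compMeasurePreserving _ _
    filter_upwards [coeFn_tfShift g z, coeFn_tfShift (τ z.fst) (WithLp.toLp 2 (0, z.snd)), h0]
      with t h1 h2 h3
    simp [h1, h2, h3]
  refine continuous_iff_continuousAt.mpr fun z₀ => ?_
  rw [ContinuousAt, tendsto_iff_norm_sub_tendsto_zero]
  have hlim : Filter.Tendsto (fun z : Phase d => ‖τ z.fst - τ z₀.fst‖ +
      ‖tfShift (τ z₀.fst) (WithLp.toLp 2 (0, z.snd)) -
        tfShift (τ z₀.fst) (WithLp.toLp 2 (0, z₀.snd))‖) (nhds z₀) (nhds (0 + 0)) := by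
    refine Filter.Tendsto.add ?_ ?_
    · have : Continuous fun z : Phase d => ‖τ z.fst - τ z₀.fst‖ :=
        ((hτ.comp (WithLp.prod_continuous_ofLp _ _ _ |>.fst)).sub continuous_const).norm
      simpa using this.tendsto z₀
    · exact (tendsto_norm_modulation_sub (τ z₀.fst) z₀.snd).comp
        ((WithLp.prod_continuous_ofLp _ _ _ |>.snd).tendsto z₀)
  rw [add_zero] at hlim
  refine squeeze_zero (fun _ => norm_nonneg _) (fun z => ?_) hlim
  rw [hψ z, hψ z₀, ← norm_tfShift (τ z.fst - τ z₀.fst) (WithLp.toLp 2 (0, z.snd)), tfShift_sub]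
  exact norm_sub_le_norm_sub_add_norm_sub _ _ _

theorem continuous_stft (g f : L2 d) : Continuous (stft g f) := by
  simp_rw [funext (stft_eq_inner g f)]
  exact (continuous_tfShift g).inner continuous_const

open FourierTransform in
theorem stft_toLp_eq_fourier (g f : L2 d) (x ξ : EuclideanSpace ℝ (Fin d)) :
    stft g f (WithLp.toLp 2 (x, ξ)) = 𝓕 (fun t => f t * conj (g (t - x))) ξ := by
  rw [Real.fourier_eq', stft]
  refine integral_congr_ae (.of_forall fun t => ?_)
  simp only [smul_eq_mul]
  rw [mul_comm, real_inner_comm]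
  congr 2
  push_cast
  change -(2 * Real.pi * I * (⟪t, ξ⟫_ℝ : ℂ)) = _
  ring

/-- Moyal's identity: Plancherel's formula in the frequency variable, followed by Tonelli's theorem
and the translation invariance of the measure. -/
theorem lintegral_enorm_stft_sq (g f : L2 d) :
    ∫⁻ z, ‖stft g f z‖ₑ ^ 2 = ‖f‖ₑ ^ 2 * ‖g‖ₑ ^ 2 := by
  have hshift (x : EuclideanSpace ℝ (Fin d)) : MemLp (fun t => conj (g (t - x))) 2 volume :=
    ((Lp.memLp g).comp_measurePreserving (measurePreserving_sub_right volume x)).star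
  have hint (x : EuclideanSpace ℝ (Fin d)) : Integrable (fun t => f t * conj (g (t - x))) :=
    (Lp.memLp f).integrable_mul (hshift x)
  have hfm : Measurable f := (Lp.stronglyMeasurable f).measurable
  have hgm : Measurable g := (Lp.stronglyMeasurable g).measurable
  have hprod : Measurable (fun p : EuclideanSpace ℝ (Fin d) × EuclideanSpace ℝ (Fin d) =>
      ‖f p.2 * conj (g (p.2 - p.1))‖ₑ ^ 2) := by
    have : Measurable (starRingEnd ℂ) := Complex.continuous_conj.measurable
    fun_prop
  have hT : ∫⁻ x, ∫⁻ t, ‖f t * conj (g (t - x))‖ₑ ^ 2 = ‖f‖ₑ ^ 2 * ‖g‖ₑ ^ 2 := by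
    rw [lintegral_lintegral_swap hprod.aemeasurable, enorm_sq_eq_lintegral f,
      enorm_sq_eq_lintegral g, ← lintegral_mul_const _ (by fun_prop)]
    refine lintegral_congr fun t => ?_
    rw [← lintegral_sub_left_eq_self _ t, ← lintegral_const_mul _ (by fun_prop)]
    refine lintegral_congr fun x => ?_
    rw [enorm_mul, RCLike.enorm_conj, mul_pow, sub_sub_cancel]
  -- For almost every `x` the windowed signal is square-integrable, so that Plancherel's formula
  -- applies in the frequency variable.
  have hmeas : AEMeasurable (fun x => ∫⁻ t, ‖f t * conj (g (t - x))‖ₑ ^ 2) :=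
    hprod.lintegral_prod_right'.aemeasurable
  have hfin : ∀ᵐ x, ∫⁻ t, ‖f t * conj (g (t - x))‖ₑ ^ 2 < ∞ := by
    refine ae_lt_top' hmeas ?_
    rw [hT]
    finiteness
  rw [← (WithLp.volume_preserving_toLp _ _).lintegral_comp
    ((continuous_stft g f).measurable.enorm.pow_const 2), Measure.volume_eq_prod,
    lintegral_prod _ (by
      have := continuous_stft g f
      fun_prop), ← hT]
  refine lintegral_congr_ae ?_
  filter_upwards [hfin] with x hx
  simp_rw [stft_toLp_eq_fourier]
  refine lintegral_enorm_fourier_sq (hint x) ⟨(hint x).1, ?_⟩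
  rw [← eLpNorm_two_sq] at hx
  by_contra h
  simp [top_le_iff.mp (not_lt.mp h)] at hx

/-! ### Translates of sets of finite perimeter -/

section Perimeter

theorem hasCompactSupport_segment_average {E : Type*} [NormedAddCommGroup E]
    [NormedSpace ℝ E] {ψ : E → ℝ} (hc : HasCompactSupport ψ) (w : E) :
    HasCompactSupport (fun z => ∫ s in (0 : ℝ)..1, ψ (z + s • w)) := by
  have hK : IsCompact ((fun p : E × ℝ => p.1 - p.2 • w) '' (tsupport ψ ×ˢ Set.Icc (0 : ℝ) 1)) :=
    (hc.isCompact.prod isCompact_Icc).image (by fun_prop)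
  refine HasCompactSupport.intro hK fun z hz => ?_
  refine (intervalIntegral.integral_congr (g := fun _ => 0) fun s hs => ?_).trans (by simp)
  rw [Set.uIcc_of_le zero_le_one] at hs
  by_contra h
  exact hz ⟨(z + s • w, s), ⟨subset_tsupport _ h, hs⟩, by simp⟩

variable {E : Type*} [NormedAddCommGroup E] [InnerProductSpace ℝ E] [FiniteDimensional ℝ E]

theorem divergence_smul_const {u : E → ℝ} {x : E} (hu : DifferentiableAt ℝ u x) (w : E) :
    divergence (fun y => u y • w) x = fderiv ℝ u x w := by
  rw [divergence, fderiv_smul_const hu]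
  simp

variable [MeasurableSpace E] [BorelSpace E]

theorem integral_mul_divergence_le {f : E → ℝ} (hf : variation f ≠ ∞) {φ : E → E}
    (hφ : ContDiff ℝ 1 φ) (hc : HasCompactSupport φ) {M : ℝ} (hM : ∀ x, ‖φ x‖ ≤ M) :
    ∫ x, f x * divergence φ x ≤ M * (variation f).toReal := by
  have hM0 : 0 ≤ M := (norm_nonneg _).trans (hM 0)
  rcases hM0.eq_or_lt with rfl | hpos
  · have : φ = 0 := funext fun x => norm_le_zero_iff.mp (hM x)
    simp [this, divergence]
  have hdiv (x : E) : divergence (M⁻¹ • φ) x = M⁻¹ * divergence φ x := by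
    rw [divergence, divergence, fderiv_const_smul (hφ.differentiable one_ne_zero x)]
    simp
  have hle : ENNReal.ofReal (∫ x, f x * divergence (M⁻¹ • φ) x) ≤ variation f := by
    refine le_iSup_of_le (M⁻¹ • φ) (le_iSup_of_le (hφ.const_smul _) (le_iSup_of_le
      (hc.mono' ?_) (le_iSup_of_le (fun x => ?_) le_rfl)))
    · exact (Function.support_const_smul_subset _ _).trans (subset_tsupport _)
    · rw [Pi.smul_apply, norm_smul, norm_inv, Real.norm_of_nonneg hM0, inv_mul_le_one₀ hpos]
      exact hM x
  have h := (ENNReal.ofReal_le_iff_le_toReal hf).mp hle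
  simp_rw [hdiv, mul_left_comm _ M⁻¹] at h
  rwa [integral_const_mul, inv_mul_le_iff₀ hpos] at h

/-- The average of a `C¹` function over the segments from `z` to `z + w` is `C¹`: it is the
convolution with the pushforward of Lebesgue measure to a segment. -/
theorem contDiff_segment_average {E : Type*} [NormedAddCommGroup E] [InnerProductSpace ℝ E]
    [MeasurableSpace E] [BorelSpace E] {ψ : E → ℝ} (hψ : ContDiff ℝ 1 ψ) (hc : HasCompactSupport ψ)
    (w : E) : ContDiff ℝ 1 (fun z => ∫ s in (0 : ℝ)..1, ψ (z + s • w)) := by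
  have hm : Measurable (fun s : ℝ => -(s • w)) := by fun_prop
  let ν : Measure E := (volume.restrict (Set.Ioc (0 : ℝ) 1)).map (fun s : ℝ => -(s • w))
  have : IsFiniteMeasure ν := Measure.isFiniteMeasure_map _ _
  have h := hc.contDiff_convolution_right (n := 1) (f := fun _ : E => (1 : ℝ))
    (ContinuousLinearMap.mul ℝ ℝ) (μ := ν) (integrable_const 1).locallyIntegrable hψ
  refine (congrArg (ContDiff ℝ 1) (funext fun z => ?_)).mpr h
  rw [intervalIntegral.integral_of_le zero_le_one, convolution_def,
    integral_map hm.aemeasurable]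
  · simp
  · have := hψ.continuous
    exact (by fun_prop : Continuous _).aestronglyMeasurable

/-- The derivative of the segment average along the segment, from the fundamental theorem of
calculus: moving the base point along `w` slides the interval of integration. -/
theorem fderiv_segment_average {E : Type*} [NormedAddCommGroup E] [InnerProductSpace ℝ E]
    [MeasurableSpace E] [BorelSpace E] {ψ : E → ℝ} (hψ : ContDiff ℝ 1 ψ) (hc : HasCompactSupport ψ)
    (w z : E) :
    fderiv ℝ (fun z => ∫ s in (0 : ℝ)..1, ψ (z + s • w)) z w = ψ (z + w) - ψ z := by
  set u : E → ℝ := fun z => ∫ s in (0 : ℝ)..1, ψ (z + s • w) with hu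
  have hp : Continuous fun s : ℝ => ψ (z + s • w) := by
    have := hψ.continuous
    fun_prop
  have h1 : HasDerivAt (fun h : ℝ => u (z + h • w)) (fderiv ℝ u z w) 0 := by
    have hd : HasFDerivAt u (fderiv ℝ u z) (z + (0 : ℝ) • w) := by
      simpa using
        ((contDiff_segment_average hψ hc w).differentiable one_ne_zero z).hasFDerivAt
    have hl : HasDerivAt (fun h : ℝ => z + h • w) w 0 := by
      simpa using ((hasDerivAt_id (0 : ℝ)).smul_const w).const_add z
    exact hd.comp_hasDerivAt 0 hl
  have h2 : HasDerivAt (fun h : ℝ => u (z + h • w)) (ψ (z + w) - ψ z) 0 := by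
    have e : (fun h : ℝ => u (z + h • w)) = fun h =>
        (∫ s in (0 : ℝ)..h + 1, ψ (z + s • w)) - ∫ s in (0 : ℝ)..h, ψ (z + s • w) := by
      ext h
      rw [intervalIntegral.integral_interval_sub_left (hp.intervalIntegrable _ _)
        (hp.intervalIntegrable _ _), hu]
      have := intervalIntegral.integral_comp_add_left (a := 0) (b := 1)
        (fun s : ℝ => ψ (z + s • w)) h
      rw [add_zero] at this
      rw [← this]
      simp only [add_smul, add_assoc]
    have d (a : ℝ) : HasDerivAt (fun b => ∫ s in (0 : ℝ)..b, ψ (z + s • w)) (ψ (z + a • w)) a :=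
      intervalIntegral.integral_hasDerivAt_right (hp.intervalIntegrable _ _)
        (hp.stronglyMeasurableAtFilter _ _) hp.continuousAt
    rw [e]
    have d1 := (d (0 + 1)).comp_add_const 0 1
    have d2 := d1.sub (d 0)
    simp only [zero_add, one_smul, zero_smul, add_zero] at d2
    exact d2
  exact h1.unique h2

/-- Testing the variation of `f` against the segment average of `ψ`, pointing in the direction of
the translation, bounds the difference quotients of `f` in the weak sense. -/
theorem integral_mul_sub_translate_le {f : E → ℝ} (hf : variation f ≠ ∞) {ψ : E → ℝ}
    (hψ : ContDiff ℝ 1 ψ) (hc : HasCompactSupport ψ) (h01 : ∀ x, ψ x ∈ Set.Icc (0 : ℝ) 1) (w : E) :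
    ∫ x, f x * (ψ (x + w) - ψ x) ≤ ‖w‖ * (variation f).toReal := by
  set u : E → ℝ := fun z => ∫ s in (0 : ℝ)..1, ψ (z + s • w) with hu
  have hu1 : ContDiff ℝ 1 u := contDiff_segment_average hψ hc w
  have hdiv (x : E) : divergence (fun y => u y • w) x = ψ (x + w) - ψ x := by
    rw [divergence_smul_const (hu1.differentiable one_ne_zero x), fderiv_segment_average hψ hc]
  simp_rw [← hdiv]
  refine integral_mul_divergence_le hf (hu1.smul contDiff_const)
    ((hasCompactSupport_segment_average hc w).smul_right) fun x => ?_
  rw [Pi.smul_apply', norm_smul]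
  refine mul_le_of_le_one_left (norm_nonneg _) ?_
  have := intervalIntegral.norm_integral_le_of_norm_le_const (a := (0 : ℝ)) (b := 1) (C := 1)
    (f := fun s => ψ (x + s • w)) fun s _ => by
      rw [Real.norm_of_nonneg (h01 _).1]; exact (h01 _).2
  simpa using this

/-- The part of a translate of `Ω` outside `Ω` has measure at most the length of the translation
times the perimeter. -/
theorem volume_translate_diff_le {Ω : Set E} (hΩ : MeasurableSet Ω) (hfin : volume Ω ≠ ∞)
    (hper : variation (Ω.indicator (1 : E → ℝ)) ≠ ∞) (w : E) :
    volume.real ({x | x - w ∈ Ω} \ Ω) ≤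
      ‖w‖ * (variation (Ω.indicator (1 : E → ℝ))).toReal := by
  set T : Set E := {x | x - w ∈ Ω} with hT
  have hTm : MeasurableSet T := hΩ.preimage (measurable_sub_const w)
  have hTfin : volume T ≠ ∞ := by
    exact ((measurePreserving_sub_right volume w).measure_preimage hΩ.nullMeasurableSet).trans_ne hfin
  have hDm : MeasurableSet (T \ Ω) := hTm.diff hΩ
  have hDfin : volume (T \ Ω) ≠ ∞ := measure_ne_top_of_subset Set.sdiff_subset hTfin
  refine le_of_forall_pos_le_add fun ε hε => ?_
  have hε2 : ENNReal.ofReal (ε / 2) ≠ 0 := by simpa using hε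
  -- A cutoff `ψ` that is `1` on a large compact part `K` of `T \ Ω` and lives on a compact
  -- neighbourhood `L` of `K` that is hardly larger.
  obtain ⟨K, hKD, hK, hKvol⟩ := hDm.exists_isCompact_lt_add hDfin hε2
  have hKfin : volume K ≠ ∞ := hK.measure_lt_top.ne
  obtain ⟨U, hKU, hU, hUvol⟩ := K.exists_isOpen_lt_add hKfin hε2
  obtain ⟨L, hL, hKL, hLU⟩ := exists_compact_between hK hU hKU
  obtain ⟨ψ, hψ0, hψ1, hψ01⟩ := exists_contMDiffMap_zero_one_of_isClosed (n := 1)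
    (modelWithCornersSelf ℝ E) (isOpen_interior (s := L)).isClosed_compl hK.isClosed
    (Set.disjoint_left.mpr fun x hx hxK => hx (hKL hxK))
  have hψ : ContDiff ℝ 1 ψ := ψ.contMDiff.contDiff
  have hψL (x) (hx : x ∉ L) : ψ x = 0 := hψ0 fun h => hx (interior_subset h)
  have hc : HasCompactSupport ψ := HasCompactSupport.intro hL hψL
  have hψi : Integrable ψ := hψ.continuous.integrable_of_hasCompactSupport hc
  have hKr : volume.real (T \ Ω) ≤ volume.real K + ε / 2 := by
    rw [Measure.real, Measure.real, ← ENNReal.toReal_ofReal (half_pos hε).le,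
      ← ENNReal.toReal_add hKfin ENNReal.ofReal_ne_top]
    exact ENNReal.toReal_mono (ENNReal.add_ne_top.mpr ⟨hKfin, ENNReal.ofReal_ne_top⟩) hKvol.le
  have hLr : volume.real (L \ K) ≤ ε / 2 := by
    have h1 : volume L ≤ volume K + ENNReal.ofReal (ε / 2) := (measure_mono hLU).trans hUvol.le
    have h2 : volume.real L ≤ volume.real K + ε / 2 := by
      rw [Measure.real, Measure.real, ← ENNReal.toReal_ofReal (half_pos hε).le,
        ← ENNReal.toReal_add hKfin ENNReal.ofReal_ne_top]
      exact ENNReal.toReal_mono (ENNReal.add_ne_top.mpr ⟨hKfin, ENNReal.ofReal_ne_top⟩) h1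
    rw [measureReal_sdiff (hKL.trans interior_subset) hK.measurableSet hL.measure_lt_top.ne]
    linarith
  have hΩψ : Integrable fun x => Ω.indicator (1 : E → ℝ) x * ψ x := by
    refine (hψi.indicator hΩ).congr (.of_forall fun x => ?_)
    by_cases hx : x ∈ Ω <;> simp [hx]
  have hTψ : Integrable fun x => T.indicator (1 : E → ℝ) x * ψ x := by
    refine (hψi.indicator hTm).congr (.of_forall fun x => ?_)
    by_cases hx : x ∈ T <;> simp [hx]
  have hΩψ' : Integrable fun x => Ω.indicator (1 : E → ℝ) x * ψ (x + w) := by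
    refine ((hψi.comp_add_right w).indicator hΩ).congr (.of_forall fun x => ?_)
    by_cases hx : x ∈ Ω <;> simp [hx]
  have hshift : ∫ x, Ω.indicator (1 : E → ℝ) x * (ψ (x + w) - ψ x) =
      ∫ x, (T.indicator (1 : E → ℝ) x * ψ x - Ω.indicator (1 : E → ℝ) x * ψ x) := by
    simp_rw [mul_sub]
    rw [integral_sub hΩψ' hΩψ, integral_sub hTψ hΩψ,
      ← integral_sub_right_eq_self (fun x => Ω.indicator (1 : E → ℝ) x * ψ (x + w)) w]
    congr 1
    refine integral_congr_ae (.of_forall fun x => ?_)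
    simp only [sub_add_cancel]
    rfl
  have hKi : Integrable (K.indicator (1 : E → ℝ)) :=
    (integrable_indicator_iff hK.measurableSet).mpr (integrableOn_const hK.measure_lt_top.ne)
  have hLm : MeasurableSet (L \ K) := hL.measurableSet.diff hK.measurableSet
  have hLfin : volume (L \ K) ≠ ∞ :=
    measure_ne_top_of_subset Set.sdiff_subset hL.measure_lt_top.ne
  have hLi : Integrable ((L \ K).indicator (1 : E → ℝ)) :=
    (integrable_indicator_iff hLm).mpr (integrableOn_const hLfin)
  have hlow : volume.real K - volume.real (L \ K) ≤
      ∫ x, (T.indicator (1 : E → ℝ) x * ψ x - Ω.indicator (1 : E → ℝ) x * ψ x) := by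
    rw [← integral_indicator_one hK.measurableSet, ← integral_indicator_one hLm,
      ← integral_sub hKi hLi]
    refine integral_mono (hKi.sub hLi) (hTψ.sub hΩψ) fun x => ?_
    have h01 := hψ01 x
    by_cases hxK : x ∈ K
    · have hx := hKD hxK
      simp [hxK, hx.1, hx.2, show ψ x = 1 from hψ1 hxK]
    · by_cases hxL : x ∈ L
      · by_cases hxT : x ∈ T <;> by_cases hxΩ : x ∈ Ω <;>
          simp [hxK, hxL, hxT, hxΩ, h01.2]
        all_goals linarith [h01.1, h01.2]
      · simp [hxK, hxL, hψL x hxL]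
  have := integral_mul_sub_translate_le hper hψ hc hψ01 w
  rw [hshift] at this
  linarith

end Perimeter

/-! ### The localization operator and the smoothed indicator -/

open InnerProductSpace in
/-- The localization operator as a bounded operator: the integral over `Ω` of the rank-one
operators `f ↦ ⟪tfShift g z, f⟫ • tfShift g z`. -/
noncomputable def locOpCLM (g : L2 d) (Ω : Set (Phase d)) : L2 d →L[ℂ] L2 d :=
  ∫ z in Ω, rankOne ℂ (tfShift g z) (tfShift g z)

open InnerProductSpace in
theorem integrableOn_rankOne_tfShift (g : L2 d) {Ω : Set (Phase d)} (hΩ : IsCompact Ω) :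
    IntegrableOn (fun z => rankOne ℂ (tfShift g z) (tfShift g z)) Ω := by
  have h : Continuous fun z => rankOne ℂ (tfShift g z) (tfShift g z) :=
    (rankOne ℂ (E := L2 d) (F := L2 d)).flip.cont.comp (continuous_tfShift g) |>.clm_apply
      (continuous_tfShift g)
  exact h.continuousOn.integrableOn_compact hΩ

theorem locOpCLM_apply (g : L2 d) {Ω : Set (Phase d)} (hΩ : IsCompact Ω) (f : L2 d) :
    locOpCLM g Ω f = locOp g Ω f := by
  rw [locOpCLM, ContinuousLinearMap.integral_apply (integrableOn_rankOne_tfShift g hΩ), locOp]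
  simp_rw [InnerProductSpace.rankOne_apply, stft_eq_inner]

theorem inner_locOp (g : L2 d) {Ω : Set (Phase d)} (hΩ : IsCompact Ω) (f f' : L2 d) :
    ⟪f', locOp g Ω f⟫_ℂ = ∫ z in Ω, conj (stft g f' z) * stft g f z := by
  have hc : Continuous fun z => stft g f z • tfShift g z :=
    (continuous_stft g f).smul (continuous_tfShift g)
  rw [locOp, ← integral_inner (hc.continuousOn.integrableOn_compact hΩ)]
  refine integral_congr_ae (.of_forall fun z => ?_)
  simp only [inner_smul_right, stft_eq_inner, inner_conj_symm]
  ring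

theorem integrableOn_norm_stft_sq (g f : L2 d) {Ω : Set (Phase d)} (hΩ : IsCompact Ω) :
    IntegrableOn (fun z => ‖stft g f z‖ ^ 2) Ω :=
  ((continuous_stft g f).norm.pow 2).continuousOn.integrableOn_compact hΩ

theorem inner_locOp_self (g : L2 d) {Ω : Set (Phase d)} (hΩ : IsCompact Ω) (f : L2 d) :
    ⟪f, locOp g Ω f⟫_ℂ = (∫ z in Ω, ‖stft g f z‖ ^ 2 : ℝ) := by
  rw [inner_locOp g hΩ, ← integral_complex_ofReal]
  refine integral_congr_ae (.of_forall fun z => ?_)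
  simp only
  rw [Complex.conj_mul']
  push_cast
  rfl

theorem isSymmetric_locOpCLM (g : L2 d) {Ω : Set (Phase d)} (hΩ : IsCompact Ω) :
    (locOpCLM g Ω).IsSymmetric := by
  intro f f'
  change ⟪locOpCLM g Ω f, f'⟫_ℂ = ⟪f, locOpCLM g Ω f'⟫_ℂ
  rw [locOpCLM_apply g hΩ, locOpCLM_apply g hΩ, ← inner_conj_symm, inner_locOp g hΩ,
    inner_locOp g hΩ, ← integral_conj]
  refine integral_congr_ae (.of_forall fun z => ?_)
  simp [mul_comm]

/-- Closed subspaces contain the integrals of their functions. -/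
theorem integral_mem_of_isClosed {α F : Type*} [MeasurableSpace α] {μ : Measure α}
    [NormedAddCommGroup F] [NormedSpace ℝ F] [CompleteSpace F] {S : Submodule ℝ F}
    (hS : IsClosed (S : Set F)) {f : α → F} (hf : ∀ a, f a ∈ S) : ∫ a, f a ∂μ ∈ S := by
  have : CompleteSpace S := hS.completeSpace_coe
  have h := S.subtypeₗᵢ.integral_comp_comm (μ := μ) fun a => (⟨f a, hf a⟩ : S)
  exact h ▸ Submodule.coe_mem _

theorem isCompactOperator_locOpCLM (g : L2 d) (Ω : Set (Phase d)) :
    IsCompactOperator (locOpCLM g Ω) := by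
  have hcl : IsClosed (((compactOperator (RingHom.id ℂ) (L2 d) (L2 d)).restrictScalars ℝ :
      Submodule ℝ (L2 d →L[ℂ] L2 d)) : Set (L2 d →L[ℂ] L2 d)) :=
    isClosed_setOfPred_isCompactOperator
  refine integral_mem_of_isClosed (μ := volume.restrict Ω) hcl fun z => ?_
  exact (isCompactOperator_of_locallyCompactSpace_rng
    (ContinuousLinearMap.toSpanSingleton ℂ (tfShift g z))).comp_clm (innerSL ℂ (tfShift g z))


theorem integrable_norm_stft_sq (g f : L2 d) : Integrable (fun z => ‖stft g f z‖ ^ 2) := by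
  refine ⟨((continuous_stft g f).norm.pow 2).aestronglyMeasurable, ?_⟩
  rw [HasFiniteIntegral]
  simp_rw [enorm_pow, enorm_norm]
  rw [lintegral_enorm_stft_sq]
  finiteness

/-- Moyal's identity for Bochner integrals. -/
theorem integral_norm_stft_sq (g f : L2 d) :
    ∫ z, ‖stft g f z‖ ^ 2 = ‖f‖ ^ 2 * ‖g‖ ^ 2 := by
  rw [integral_eq_lintegral_of_nonneg_ae (.of_forall fun z => by positivity)
    (integrable_norm_stft_sq g f).1]
  have : ∀ z, ENNReal.ofReal (‖stft g f z‖ ^ 2) = ‖stft g f z‖ₑ ^ 2 := fun z => by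
    rw [ENNReal.ofReal_pow (norm_nonneg _), ofReal_norm]
  simp_rw [this, lintegral_enorm_stft_sq]
  simp

theorem smoothed_eq (g : L2 d) {Ω : Set (Phase d)} (hΩ : IsCompact Ω) (z : Phase d) :
    smoothed g Ω z = ∫ t in Ω, ‖stft g g (z - t)‖ ^ 2 := by
  rw [smoothed, convolution_def, ← integral_indicator hΩ.measurableSet]
  refine integral_congr_ae (.of_forall fun t => ?_)
  by_cases ht : t ∈ Ω <;> simp [ht]

theorem smoothed_eq_inner (g : L2 d) {Ω : Set (Phase d)} (hΩ : IsCompact Ω) (z : Phase d) :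
    ((smoothed g Ω z : ℝ) : ℂ) = ⟪tfShift g z, locOp g Ω (tfShift g z)⟫_ℂ := by
  rw [inner_locOp_self g hΩ, smoothed_eq g hΩ]
  simp_rw [stft_eq_inner g (tfShift g z), norm_inner_symm _ (tfShift g z), norm_inner_tfShift]

theorem integrable_indicator_one {Ω : Set (Phase d)} (hΩ : IsCompact Ω) :
    Integrable (Ω.indicator (1 : Phase d → ℝ)) :=
  (integrable_indicator_iff hΩ.measurableSet).mpr (integrableOn_const hΩ.measure_lt_top.ne)

theorem integrable_smoothed (g : L2 d) {Ω : Set (Phase d)} (hΩ : IsCompact Ω) :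
    Integrable (smoothed g Ω) :=
  (integrable_indicator_one hΩ).integrable_convolution _ (integrable_norm_stft_sq g g)

theorem integral_smoothed (g : L2 d) {Ω : Set (Phase d)} (hΩ : IsCompact Ω) :
    ∫ z, smoothed g Ω z = volume.real Ω * ‖g‖ ^ 4 := by
  rw [smoothed, integral_convolution _ (integrable_indicator_one hΩ)
    (integrable_norm_stft_sq g g), integral_indicator_one hΩ.measurableSet,
    integral_norm_stft_sq, ContinuousLinearMap.mul_apply']
  ring

/-- The portion of `1_Ω * |V_g g|²` that leaks out of `Ω` is controlled by the perimeter. -/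
theorem volume_sub_integral_smoothed_le (g : L2 d) (hgM : MemMStar g) (hg : ‖g‖ = 1)
    {Ω : Set (Phase d)} (hΩ : IsCompact Ω) (hper : perimeter Ω ≠ ∞) :
    volume.real Ω - ∫ z in Ω, smoothed g Ω z ≤ normMStar g ^ 2 * (perimeter Ω).toReal := by
  set p : Phase d → ℝ := fun z => ‖stft g g z‖ ^ 2 with hp
  have hpi : Integrable p := integrable_norm_stft_sq g g
  have hp1 : ∫ t, p t = 1 := by rw [hp, integral_norm_stft_sq, hg]; norm_num
  have hfin : volume Ω ≠ ∞ := hΩ.measure_lt_top.ne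
  let T : Phase d → Set (Phase d) := fun t => {z | z - t ∈ Ω}
  have hTm (t) : MeasurableSet (T t) := hΩ.measurableSet.preimage (measurable_sub_const t)
  have hTvol (t) : volume (T t) = volume Ω :=
    (measurePreserving_sub_right volume t).measure_preimage hΩ.measurableSet.nullMeasurableSet
  have : ProperSpace (Phase d) := FiniteDimensional.proper ℝ _
  let F : Phase d × Phase d → ℝ := fun q =>
    Ω.indicator (1 : Phase d → ℝ) q.1 * (Ω.indicator (1 : Phase d → ℝ) (q.1 - q.2) * p q.2)
  have hFi : Integrable F (volume.prod volume) := by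
    refine ((integrable_indicator_one hΩ).mul_prod hpi).mono' ?_ (.of_forall fun q => ?_)
    · have h1 : Measurable (Ω.indicator (1 : Phase d → ℝ)) :=
        measurable_one.indicator hΩ.measurableSet
      have h2 : Measurable p := ((continuous_stft g g).norm.pow 2).measurable
      exact (by fun_prop : Measurable F).aestronglyMeasurable
    · have : 0 ≤ p q.2 := by positivity
      by_cases h1 : q.1 ∈ Ω <;> by_cases h2 : q.1 - q.2 ∈ Ω <;>
        simp [F, h1, h2, abs_of_nonneg this, this]
  -- Fubini: `∫_Ω 1_Ω * p = ∫ p(t) |Ω ∩ (Ω + t)| dt`.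
  have hleft : ∫ z in Ω, smoothed g Ω z = ∫ z, ∫ t, F (z, t) := by
    rw [← integral_indicator hΩ.measurableSet]
    refine integral_congr_ae (.of_forall fun z => ?_)
    simp only [F]
    rw [integral_const_mul, ← integral_sub_left_eq_self _ volume z]
    by_cases hz : z ∈ Ω
    · simp only [Set.indicator_of_mem hz, Pi.one_apply, one_mul, sub_sub_cancel]
      rw [smoothed, convolution_def]
      rfl
    · simp [hz]
  have hright (t) : ∫ z, F (z, t) = p t * volume.real (Ω ∩ T t) := by
    rw [← integral_indicator_one (hΩ.measurableSet.inter (hTm t)), ← integral_const_mul]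
    refine integral_congr_ae (.of_forall fun z => ?_)
    by_cases h1 : z ∈ Ω <;> by_cases h2 : z - t ∈ Ω <;> simp [F, h1, h2, T]
  have hswap : ∫ z in Ω, smoothed g Ω z = ∫ t, p t * volume.real (Ω ∩ T t) := by
    rw [hleft, integral_integral_swap hFi]
    simp_rw [hright]
  have hi : Integrable fun t => p t * volume.real (Ω ∩ T t) := by
    simpa only [hright] using hFi.integral_prod_right
  have hloc (t) : volume.real Ω - volume.real (Ω ∩ T t) ≤ ‖t‖ * (perimeter Ω).toReal := by
    have h1 := volume_translate_diff_le hΩ.measurableSet hfin hper t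
    have h2 := measureReal_inter_add_sdiff (μ := volume) (s := T t) hΩ.measurableSet
      (by rwa [hTvol])
    have h3 : volume.real (T t) = volume.real Ω := by rw [Measure.real, hTvol, Measure.real]
    rw [Set.inter_comm (T t)] at h2
    change volume.real (T t \ Ω) ≤ _ at h1
    rw [perimeter]
    linarith
  calc volume.real Ω - ∫ z in Ω, smoothed g Ω z
      = ∫ t, p t * (volume.real Ω - volume.real (Ω ∩ T t)) := by
        simp_rw [mul_sub]
        rw [integral_sub (hpi.mul_const _) hi, integral_mul_const, hp1, one_mul, hswap]
    _ ≤ ∫ t, ‖t‖ * p t * (perimeter Ω).toReal := by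
        refine integral_mono ?_ (hgM.mul_const _) fun t => ?_
        · simp_rw [mul_sub]
          exact (hpi.mul_const _).sub hi
        · have : 0 ≤ p t := by positivity
          calc p t * (volume.real Ω - volume.real (Ω ∩ T t))
              ≤ p t * (‖t‖ * (perimeter Ω).toReal) := by gcongr; exact hloc t
            _ = ‖t‖ * p t * (perimeter Ω).toReal := by ring
    _ = normMStar g ^ 2 * (perimeter Ω).toReal := by
        rw [integral_mul_const, normMStar, Real.sq_sqrt]
        positivity

/-! ### Spectral sums -/

/-- Parseval's identity for an orthonormal family that need not be complete, at a vector orthogonal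
to everything that the family does not see. -/
theorem hasSum_norm_inner_sq_of_orthonormal {H κ : Type*} [NormedAddCommGroup H]
    [InnerProductSpace ℂ H] [CompleteSpace H] {v : κ → H} (hv : Orthonormal ℂ v) {u : H}
    (hu : ∀ f : H, (∀ k, ⟪v k, f⟫_ℂ = 0) → ⟪f, u⟫_ℂ = 0) :
    HasSum (fun k => ‖⟪v k, u⟫_ℂ‖ ^ 2) (‖u‖ ^ 2) := by
  obtain ⟨w, b, hsw, hb⟩ := hv.toSubtypeRange.exists_hilbertBasis_extension
  let i : κ → w := fun k => ⟨v k, hsw ⟨k, rfl⟩⟩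
  have hi : Function.Injective i := fun j k hjk => by
    by_contra hne
    have h0 : ⟪v j, v k⟫_ℂ = 0 := hv.2 hne
    have hjk' : v j = v k := congrArg Subtype.val hjk
    rw [hjk', inner_self_eq_norm_sq_to_K, hv.1 k] at h0
    simp at h0
  have h := b.hasSum_inner_mul_inner u u
  have hre : HasSum (fun x : w => ‖⟪b x, u⟫_ℂ‖ ^ 2) (‖u‖ ^ 2) := by
    rw [inner_self_eq_norm_sq_to_K] at h
    have h' := Complex.hasSum_re h
    convert h' using 1
    · ext x
      rw [← inner_conj_symm, Complex.norm_conj, Complex.mul_conj']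
      norm_cast
    · norm_cast
  have hout : ∀ x ∉ Set.range i, ‖⟪b x, u⟫_ℂ‖ ^ 2 = 0 := fun x hx => by
    have hz : ⟪b x, u⟫_ℂ = 0 := hu _ fun k => by
      have hk : v k = b (i k) := by rw [hb]
      rw [hk]
      exact b.orthonormal.2 fun h => hx ⟨k, h⟩
    simp [hz]
  convert (hi.hasSum_iff hout).mpr hre using 1
  ext k
  simp [i, hb]

/-- Termwise integration of a series of nonnegative functions. -/
theorem hasSum_integral_of_nonneg {α κ : Type*} [MeasurableSpace α] [Countable κ] {μ : Measure α}
    {F : κ → α → ℝ} {G : α → ℝ} (hF : ∀ k, Integrable (F k) μ) (h0 : ∀ k a, 0 ≤ F k a)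
    (hG : Integrable G μ) (hs : ∀ᵐ a ∂μ, HasSum (fun k => F k a) (G a)) :
    HasSum (fun k => ∫ a, F k a ∂μ) (∫ a, G a ∂μ) := by
  have hsum : Summable fun k => ∫ a, ‖F k a‖ ∂μ := by
    refine summable_of_sum_le (c := ∫ a, G a ∂μ) (fun k => by positivity) fun s => ?_
    rw [← integral_finsetSum s (f := fun k a => ‖F k a‖) fun k _ => (hF k).norm]
    refine integral_mono_ae (integrable_finsetSum s fun k _ => (hF k).norm) hG ?_
    filter_upwards [hs] with a ha
    simp_rw [Real.norm_of_nonneg (h0 _ a)]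
    exact sum_le_hasSum s (fun k _ => h0 k a) ha
  have h := hasSum_integral_of_summable_integral_norm (μ := μ) hF hsum
  have e : ∫ a, G a ∂μ = ∫ a, ∑' k, F k a ∂μ := by
    refine integral_congr_ae ?_
    filter_upwards [hs] with a ha
    exact ha.tsum_eq.symm
  rwa [e]

/-- For a nonincreasing sequence in `[0, 1]`, the tail beyond the index `A` is at most
`∑ l k * (1 - l k)` as soon as `A` is at least the sum of the sequence. -/
theorem tail_le_of_antitone {l : ℕ → ℝ} (hl : Antitone l) (h0 : ∀ k, 0 ≤ l k) (h1 : ∀ k, l k ≤ 1)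
    {V Q : ℝ} (hV : HasSum l V) (hQ : HasSum (fun k => l k ^ 2) Q) {A : ℕ} (hA : V ≤ A) :
    V - ∑ k ∈ Finset.range A, l k ≤ V - Q := by
  set m := l A with hm
  have hfin : HasSum (fun k => if k ∈ Finset.range A then m - l k else 0)
      (∑ k ∈ Finset.range A, (m - l k)) := by
    have := hasSum_sum_of_ne_finset_zero (f := fun k => if k ∈ Finset.range A then m - l k else 0)
      (s := Finset.range A) (L := .unconditional ℕ) (fun k hk => if_neg hk)
    rwa [Finset.sum_congr rfl fun k hk => if_pos hk] at this
  have hle := hasSum_le (fun k => ?_) ((hV.mul_left (1 - m)).add hfin) (hV.sub hQ)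
  · rw [Finset.sum_sub_distrib, Finset.sum_const, Finset.card_range, nsmul_eq_mul] at hle
    have : 0 ≤ m * (A - V) := mul_nonneg (h0 A) (sub_nonneg.mpr hA)
    linarith
  · by_cases hk : k < A
    · have hmk : m ≤ l k := hl hk.le
      simp only [Finset.mem_range, hk, if_true]
      nlinarith [mul_nonneg (sub_nonneg.mpr hmk) (sub_nonneg.mpr (h1 k))]
    · have hmk : l k ≤ m := hl (not_lt.mp hk)
      simp only [Finset.mem_range, hk, if_false]
      nlinarith [mul_nonneg (h0 k) (sub_nonneg.mpr hmk)]

namespace IsEigensystem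

variable {g : L2 d} {Ω : Set (Phase d)} {N : ℕ∞} {lam : ℕ → ℝ} {h : ℕ → L2 d}

theorem norm_eq_one (he : IsEigensystem g Ω N lam h) {k : ℕ} (hk : (k : ℕ∞) < N) : ‖h k‖ = 1 :=
  he.orthonormal.1 ⟨k, hk⟩

theorem lam_eq_integral (he : IsEigensystem g Ω N lam h) (hΩ : IsCompact Ω) {k : ℕ}
    (hk : (k : ℕ∞) < N) : lam k = ∫ z in Ω, ‖stft g (h k) z‖ ^ 2 := by
  have h1 := inner_locOp_self g hΩ (h k)
  rw [he.eigen k hk, inner_smul_right, inner_self_eq_norm_sq_to_K, he.norm_eq_one hk] at h1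
  simpa using congrArg Complex.re h1

theorem lam_nonneg (he : IsEigensystem g Ω N lam h) (hΩ : IsCompact Ω) {k : ℕ}
    (hk : (k : ℕ∞) < N) : 0 ≤ lam k := by
  rw [he.lam_eq_integral hΩ hk]
  positivity

theorem lam_le_one (he : IsEigensystem g Ω N lam h) (hg : ‖g‖ = 1) (hΩ : IsCompact Ω) {k : ℕ}
    (hk : (k : ℕ∞) < N) : lam k ≤ 1 := by
  rw [he.lam_eq_integral hΩ hk]
  refine (setIntegral_le_integral (integrable_norm_stft_sq g (h k))
    (.of_forall fun z => by positivity)).trans ?_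
  rw [integral_norm_stft_sq, he.norm_eq_one hk, hg]
  norm_num

theorem hasSum_smoothed (he : IsEigensystem g Ω N lam h) (hΩ : IsCompact Ω) (z : Phase d) :
    HasSum (fun k : {k : ℕ // (k : ℕ∞) < N} => lam k * ‖stft g (h k) z‖ ^ 2)
      (smoothed g Ω z) := by
  have h1 := (he.diagonal (tfShift g z)).mapL (innerSL ℂ (tfShift g z))
  have h2 := Complex.hasSum_re h1
  rw [innerSL_apply_apply, ← smoothed_eq_inner g hΩ, Complex.ofReal_re] at h2
  convert h2 using 1
  ext k
  rw [innerSL_apply_apply, inner_smul_right, mul_assoc, ← inner_conj_symm, Complex.conj_mul',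
    ← stft_eq_inner]
  norm_cast

/-- The eigenfunctions span the time-frequency shifts by almost every point of `Ω`: a vector
orthogonal to all eigenfunctions is annihilated by the localization operator, so that its
short-time Fourier transform vanishes almost everywhere on `Ω`. -/
theorem ae_hasSum_one (he : IsEigensystem g Ω N lam h) (hg : ‖g‖ = 1) (hΩ : IsCompact Ω) :
    ∀ᵐ z ∂volume.restrict Ω,
      HasSum (fun k : {k : ℕ // (k : ℕ∞) < N} => ‖stft g (h k) z‖ ^ 2) 1 := by
  let K : Submodule ℂ (L2 d) :=
    Submodule.span ℂ (Set.range fun k : {k : ℕ // (k : ℕ∞) < N} => h k)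
  have hK (f : L2 d) : f ∈ Kᗮ ↔ ∀ k : {k : ℕ // (k : ℕ∞) < N}, ⟪h k, f⟫_ℂ = 0 := by
    rw [Submodule.mem_orthogonal]
    refine ⟨fun hf k => hf _ (Submodule.subset_span ⟨k, rfl⟩), fun hf u hu => ?_⟩
    induction hu using Submodule.span_induction with
    | mem x hx => obtain ⟨k, rfl⟩ := hx; exact hf k
    | zero => exact inner_zero_left _
    | add x y _ _ hx hy => rw [inner_add_left, hx, hy, add_zero]
    | smul a x _ hx => rw [inner_smul_left, hx, mul_zero]
  have hzero (f : L2 d) (hf : f ∈ Kᗮ) : stft g f =ᵐ[volume.restrict Ω] 0 := by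
    have h0 : locOp g Ω f = 0 := by
      refine (he.diagonal f).unique ?_
      convert hasSum_zero with k
      rw [(hK f).mp hf k]
      simp
    have h1 := inner_locOp_self g hΩ f
    rw [h0, inner_zero_right] at h1
    have h2 : ∫ z in Ω, ‖stft g f z‖ ^ 2 = 0 := by exact_mod_cast h1.symm
    rw [integral_eq_zero_iff_of_nonneg (fun z => by positivity)
      (integrableOn_norm_stft_sq g f hΩ)] at h2
    filter_upwards [h2] with z hz
    simpa using hz
  have : Fact ((2 : ℝ≥0∞) ≠ ∞) := ⟨by norm_num⟩
  have hproj : (fun z => Kᗮ.starProjection (tfShift g z)) =ᵐ[volume.restrict Ω] 0 := by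
    refine ae_eq_zero_of_forall_inner (𝕜 := ℂ) fun c => ?_
    filter_upwards [hzero (Kᗮ.starProjection c) (Submodule.starProjection_apply_mem _ _)] with z hz
    rw [stft_eq_inner] at hz
    rw [← Submodule.inner_starProjection_left_eq_right, ← inner_conj_symm, hz]
    simp
  filter_upwards [hproj] with z hz
  have := hasSum_norm_inner_sq_of_orthonormal he.orthonormal (u := tfShift g z) fun f hf => by
    have hfK : f ∈ Kᗮ := (hK f).mpr hf
    rw [← Submodule.starProjection_eq_self_iff.mpr hfK,
      Submodule.inner_starProjection_left_eq_right, hz]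
    simp
  rw [norm_tfShift, hg, one_pow] at this
  simpa only [stft_eq_inner, norm_inner_symm (tfShift g z)] using this

/-- The trace of the localization operator. -/
theorem hasSum_lam (he : IsEigensystem g Ω N lam h) (hg : ‖g‖ = 1) (hΩ : IsCompact Ω) :
    HasSum (fun k : {k : ℕ // (k : ℕ∞) < N} => lam k) (volume.real Ω) := by
  have := hasSum_integral_of_nonneg (μ := volume.restrict Ω)
    (fun k : {k : ℕ // (k : ℕ∞) < N} => integrableOn_norm_stft_sq g (h k) hΩ)
    (fun k z => by positivity) (integrableOn_const hΩ.measure_lt_top.ne) (he.ae_hasSum_one hg hΩ)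
  rw [funext fun k : {k : ℕ // (k : ℕ∞) < N} => he.lam_eq_integral hΩ k.2]
  simpa using this

/-- The squared Hilbert-Schmidt norm of the localization operator. -/
theorem hasSum_lam_sq (he : IsEigensystem g Ω N lam h) (hΩ : IsCompact Ω) :
    HasSum (fun k : {k : ℕ // (k : ℕ∞) < N} => lam k ^ 2) (∫ z in Ω, smoothed g Ω z) := by
  have := hasSum_integral_of_nonneg (μ := volume.restrict Ω)
    (fun k : {k : ℕ // (k : ℕ∞) < N} =>
      (integrableOn_norm_stft_sq g (h k) hΩ).const_mul (lam k))
    (fun k z => mul_nonneg (he.lam_nonneg hΩ k.2) (by positivity))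
    (integrable_smoothed g hΩ).integrableOn (.of_forall (he.hasSum_smoothed hΩ))
  convert this using 1
  ext k
  rw [integral_const_mul, ← he.lam_eq_integral hΩ k.2, sq]

end IsEigensystem

/-! ### Diagonalization -/

/-- A lower set of natural numbers is an initial segment, possibly everything. -/
theorem exists_forall_mem_iff_lt_of_isLowerSet {S : Set ℕ} (hS : IsLowerSet S) :
    ∃ N : ℕ∞, ∀ k : ℕ, k ∈ S ↔ (k : ℕ∞) < N := by
  classical
  by_cases h : ∃ n, n ∉ S
  · refine ⟨(Nat.find h : ℕ), fun k => ?_⟩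
    rw [Nat.cast_lt]
    refine ⟨fun hk => ?_, fun hk => not_not.mp (Nat.find_min h hk)⟩
    by_contra hlt
    exact Nat.find_spec h (hS (not_lt.mp hlt) hk)
  · push Not at h
    exact ⟨⊤, fun k => ⟨fun _ => ENat.natCast_lt_top k, fun _ => h k⟩⟩

/-- A family of positive numbers of which only finitely many exceed any given positive bound can be
listed in nonincreasing order: the position of an index is the number of indices preceding it, when
ties are broken by some injection into the natural numbers. -/
theorem exists_antitone_enumeration {ι : Type*} {a : ι → ℝ} (hpos : ∀ i, 0 < a i)
    (hfin : ∀ ε > 0, {i | ε ≤ a i}.Finite) :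
    ∃ (N : ℕ∞) (e : {k : ℕ // (k : ℕ∞) < N} ≃ ι), ∀ j k, j ≤ k → a (e k) ≤ a (e j) := by
  have hcount : Countable ι := by
    rw [← Set.countable_univ_iff]
    have : (Set.univ : Set ι) = ⋃ n : ℕ, {i | 1 / ((n : ℝ) + 1) ≤ a i} := by
      symm
      rw [Set.eq_univ_iff_forall]
      intro i
      obtain ⟨n, hn⟩ := exists_nat_one_div_lt (hpos i)
      exact Set.mem_iUnion.mpr ⟨n, hn.le⟩
    rw [this]
    exact Set.countable_iUnion fun n => (hfin _ (by positivity)).countable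
  obtain ⟨c, hc⟩ := exists_injective_nat ι
  let prec : ι → ι → Prop := fun j i => a i < a j ∨ (a j = a i ∧ c j < c i)
  have hprec_fin (i) : {j | prec j i}.Finite := (hfin (a i) (hpos i)).subset fun j hj => by
    rcases hj with h | h
    · exact h.le
    · exact h.1.ge
  have hirr (i) : ¬ prec i i := by simp [prec]
  have htrans {i j k} (h1 : prec i j) (h2 : prec j k) : prec i k := by
    simp only [prec] at *
    grind
  have htri {i j} (h : i ≠ j) : prec i j ∨ prec j i := by
    have := hc.ne h
    simp only [prec]
    grind
  let rank : ι → ℕ := fun i => {j | prec j i}.ncard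
  have hrank {j i} (h : prec j i) : rank j < rank i := by
    refine Set.ncard_lt_ncard ⟨fun k hk => htrans hk h, fun hsub => hirr j (hsub h)⟩ (hprec_fin i)
  have hinj : Function.Injective rank := fun i j hij => by
    by_contra hne
    rcases htri hne with h | h
    · exact (hrank h).ne hij
    · exact (hrank h).ne' hij
  have hlow : IsLowerSet (Set.range rank) := by
    rintro _ m hm ⟨i, rfl⟩
    rcases hm.eq_or_lt with rfl | hlt
    · exact ⟨i, rfl⟩
    -- The predecessors of `i` have distinct positions below that of `i`, so these fill up.
    have himg : rank '' {j | prec j i} = Set.Iio (rank i) := by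
      refine Set.eq_of_subset_of_ncard_le ?_ ?_ (Set.finite_Iio _)
      · rintro _ ⟨j, hj, rfl⟩
        exact hrank hj
      · rw [Set.ncard_image_of_injective _ hinj, Set.ncard_eq_toFinset_card', Set.toFinset_Iio,
          Nat.card_Iio]
    obtain ⟨j, -, hj⟩ := himg.symm.subset hlt
    exact ⟨j, hj⟩
  obtain ⟨N, hN⟩ := exists_forall_mem_iff_lt_of_isLowerSet hlow
  let e : {k : ℕ // (k : ℕ∞) < N} ≃ ι :=
    ((Equiv.ofInjective rank hinj).trans (Equiv.subtypeEquivRight hN)).symm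
  have he (k) : rank (e k) = k := congrArg Subtype.val (e.symm_apply_apply k)
  refine ⟨N, e, fun j k hjk => ?_⟩
  by_contra hlt
  have := hrank (Or.inl (not_le.mp hlt) : prec (e k) (e j))
  rw [he, he] at this
  exact absurd hjk (not_le.mpr this)

/-- The spectral theorem for a compact symmetric operator on a Hilbert space: there is a Hilbert
basis of eigenvectors. -/
theorem exists_hilbertBasis_eigenvectors {H : Type} [NormedAddCommGroup H] [InnerProductSpace ℂ H]
    [CompleteSpace H] {T : H →L[ℂ] H} (hT : IsCompactOperator T) (hS : T.IsSymmetric) :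
    ∃ (κ : Type) (b : HilbertBasis κ ℂ H) (m : κ → ℂ), ∀ i, T (b i) = m i • b i := by
  let G : ℂ → Submodule ℂ H := fun μ => Module.End.eigenspace (T : Module.End ℂ H) μ
  have hG (μ) (x) : x ∈ G μ ↔ T x = μ • x := Module.End.mem_eigenspace_iff
  have hcomplete (μ) : CompleteSpace (G μ) := by
    have : IsClosed (G μ : Set H) := by
      have : (G μ : Set H) = {x | T x = μ • x} := Set.ext fun x => hG μ x
      rw [this]
      exact isClosed_eq T.continuous (continuous_const_smul μ)
    exact this.completeSpace_coe
  choose w b hb using fun μ => exists_hilbertBasis ℂ (G μ)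
  have hort : Orthonormal ℂ fun i : Σ μ, w μ => (b i.1 i.2 : H) :=
    (LinearMap.IsSymmetric.orthogonalFamily_eigenspaces hS).orthonormal_sigma_orthonormal
      fun μ => (b μ).orthonormal
  have htop : (Submodule.span ℂ (Set.range fun i : Σ μ, w μ => (b i.1 i.2 : H)))ᗮ = ⊥ := by
    rw [eq_bot_iff, ← ContinuousLinearMap.orthogonalComplement_iSup_eigenspaces_eq_bot hT hS,
      ← Submodule.iInf_orthogonal]
    intro f hf
    rw [Submodule.mem_orthogonal'] at hf
    refine Submodule.mem_iInf _ |>.mpr fun μ => ?_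
    rw [Submodule.mem_orthogonal']
    intro x hx
    have h1 := ((b μ).hasSum_repr ⟨x, hx⟩).mapL ((innerSL ℂ f).comp (G μ).subtypeL)
    refine h1.unique ?_
    convert hasSum_zero with i
    simp [hf _ (Submodule.subset_span ⟨⟨μ, i⟩, rfl⟩)]
  refine ⟨_, HilbertBasis.mkOfOrthogonalEqBot hort htop, fun i => i.1, fun i => ?_⟩
  rw [HilbertBasis.coe_mkOfOrthogonalEqBot]
  exact (hG _ _).mp (b i.1 i.2).2

/-- Bessel's inequality at the time-frequency shifts, integrated over `Ω`: it bounds the partial traces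
of the localization operator. -/
theorem sum_integral_norm_stft_sq_le {κ : Type*} (g : L2 d) {Ω : Set (Phase d)} (hΩ : IsCompact Ω)
    {v : κ → L2 d} (hv : Orthonormal ℂ v) (s : Finset κ) :
    ∑ i ∈ s, ∫ z in Ω, ‖stft g (v i) z‖ ^ 2 ≤ ‖g‖ ^ 2 * volume.real Ω := by
  rw [← integral_finsetSum s fun i _ => integrableOn_norm_stft_sq g (v i) hΩ]
  calc ∫ z in Ω, ∑ i ∈ s, ‖stft g (v i) z‖ ^ 2 ≤ ∫ z in Ω, ‖g‖ ^ 2 := by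
        refine integral_mono (integrable_finsetSum s fun i _ =>
          integrableOn_norm_stft_sq g (v i) hΩ)
          (integrableOn_const hΩ.measure_lt_top.ne) fun z => ?_
        simp_rw [stft_eq_inner, norm_inner_symm (tfShift g z)]
        rw [← norm_tfShift g z]
        exact hv.sum_inner_products_le _
    _ = ‖g‖ ^ 2 * volume.real Ω := by simp [mul_comm]

/-- The localization operator on a compact set can be diagonalized. -/
theorem exists_isEigensystem (g : L2 d) {Ω : Set (Phase d)} (hΩ : IsCompact Ω) :
    ∃ (N : ℕ∞) (lam : ℕ → ℝ) (h : ℕ → L2 d), IsEigensystem g Ω N lam h := by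
  obtain ⟨κ, b, m, hm⟩ := exists_hilbertBasis_eigenvectors (isCompactOperator_locOpCLM g Ω)
    (isSymmetric_locOpCLM g hΩ)
  let a : κ → ℝ := fun i => ∫ z in Ω, ‖stft g (b i) z‖ ^ 2
  have ha0 (i) : 0 ≤ a i := integral_nonneg fun z => by positivity
  have hab (i) : locOp g Ω (b i) = (a i : ℂ) • b i := by
    have h1 := inner_locOp_self g hΩ (b i)
    have h2 := hm i
    rw [locOpCLM_apply g hΩ] at h2
    rw [h2, inner_smul_right, inner_self_eq_norm_sq_to_K, b.orthonormal.1 i] at h1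
    rw [h2, ← h1]
    simp
  let ι := {i : κ // a i ≠ 0}
  have hfin (ε : ℝ) (hε : 0 < ε) : {i : ι | ε ≤ a i}.Finite := by
    by_contra hinf
    obtain ⟨n, hn⟩ := exists_nat_gt (‖g‖ ^ 2 * volume.real Ω / ε)
    obtain ⟨s, hs, hcard⟩ := Set.Infinite.exists_subset_card_eq hinf n
    have h1 := sum_integral_norm_stft_sq_le g hΩ
      (b.orthonormal.comp (Subtype.val : ι → κ) Subtype.val_injective) s
    have h2 : (s.card : ℝ) * ε ≤ ∑ i ∈ s, a i := by
      rw [← nsmul_eq_mul]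
      exact Finset.card_nsmul_le_sum s _ _ fun i hi => hs hi
    rw [hcard] at h2
    rw [div_lt_iff₀ hε] at hn
    exact absurd (hn.trans_le (h2.trans h1)) (lt_irrefl _)
  obtain ⟨N, e, he⟩ := exists_antitone_enumeration
    (fun i : ι => (ha0 i).lt_of_ne' i.2) hfin
  refine ⟨N, fun k => if hk : (k : ℕ∞) < N then a (e ⟨k, hk⟩) else 0,
    fun k => if hk : (k : ℕ∞) < N then b (e ⟨k, hk⟩) else 0, ?_, ?_, ?_, ?_, ?_⟩
  · have h1 := b.orthonormal.comp (fun k => (e k : κ)) (Subtype.val_injective.comp e.injective)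
    convert h1 with k
    simp [k.2]
  · intro k hk
    simp only [hk, dif_pos]
    exact (e ⟨k, hk⟩).2
  · intro k hk
    simp only [hk, dif_pos]
    exact hab _
  · intro j hj k hk hjk
    simp only [Set.mem_ofPred_eq] at hj hk
    simp only [hj, hk, dif_pos]
    exact he _ _ hjk
  · intro f
    have h1 := (b.hasSum_repr f).mapL (locOpCLM g Ω)
    rw [locOpCLM_apply g hΩ] at h1
    have h2 : HasSum (fun i : κ => ((a i : ℂ) * ⟪b i, f⟫_ℂ) • b i) (locOp g Ω f) := by
      convert h1 using 1
      ext1 i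
      rw [map_smul, locOpCLM_apply g hΩ, hab, smul_smul, b.repr_apply_apply, mul_comm]
    have h3 : HasSum (fun i : ι => ((a i : ℂ) * ⟪b i, f⟫_ℂ) • b i) (locOp g Ω f) := by
      refine (Function.Injective.hasSum_iff Subtype.val_injective fun i hi => ?_).mpr h2
      have : a i = 0 := by
        by_contra h
        exact hi ⟨⟨i, h⟩, rfl⟩
      simp [this]
    convert e.hasSum_iff.mpr h3 with k
    simp [k.2]

/-! ### The error of the accumulated spectrogram -/

/-- Extension by zero of a sum over an initial segment of the natural numbers. -/
theorem hasSum_extend_zero {N : ℕ∞} {f : ℕ → ℝ} {s : ℝ}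
    (hf : HasSum (fun k : {k : ℕ // (k : ℕ∞) < N} => f k) s) :
    HasSum (fun k : ℕ => if (k : ℕ∞) < N then f k else 0) s := by
  refine (Function.Injective.hasSum_iff
    (Subtype.val_injective (p := fun k : ℕ => (k : ℕ∞) < N)) fun k hk => ?_).mp ?_
  · exact if_neg fun h => hk ⟨⟨k, h⟩, rfl⟩
  · convert hf with k
    simp [k.2]

theorem integrable_accSpec_sub_smoothed (g : L2 d) {Ω : Set (Phase d)}
    (hΩ : IsCompact Ω) (h : ℕ → L2 d) :
    Integrable (fun z => accSpec g Ω h z - smoothed g Ω z) :=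
  (integrable_finsetSum _ fun k _ => integrable_norm_stft_sq g (h k)).sub
    (integrable_smoothed g hΩ)

namespace IsEigensystem

variable {g : L2 d} {Ω : Set (Phase d)} {N : ℕ∞} {lam : ℕ → ℝ} {h : ℕ → L2 d}

/-- Each eigenvalue is at most `1` and they sum to `|Ω|`, so that there are at least `⌈|Ω|⌉`. -/
theorem numEig_le (he : IsEigensystem g Ω N lam h) (hg : ‖g‖ = 1) (hΩ : IsCompact Ω) :
    (numEig Ω : ℕ∞) ≤ N := by
  by_contra hlt
  rw [not_le] at hlt
  obtain ⟨n, rfl⟩ := ENat.ne_top_iff_exists.mp hlt.ne_top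
  rw [Nat.cast_lt, numEig, Nat.lt_ceil] at hlt
  have h1 := hasSum_extend_zero (he.hasSum_lam hg hΩ)
  have h2 := hasSum_sum_of_ne_finset_zero (s := Finset.range n) (L := .unconditional ℕ)
    (f := fun k : ℕ => if (k : ℕ∞) < n then lam k else 0) fun k hk => if_neg (by simpa using hk)
  have h3 : ∑ k ∈ Finset.range n, (if (k : ℕ∞) < n then lam k else 0) ≤ n := by
    refine (Finset.sum_le_card_nsmul _ _ 1 fun k hk => ?_).trans (by simp)
    have hk' : (k : ℕ∞) < n := by simpa using hk
    rw [if_pos hk']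
    exact he.lam_le_one hg hΩ hk'
  rw [h1.unique h2] at hlt
  linarith

/-- The mass of the eigenvalues beyond the first `⌈|Ω|⌉` is at most `∑ lam k * (1 - lam k)`,
which the trace formulas for the localization operator and its square express through `smoothed`. -/
theorem tail_le (he : IsEigensystem g Ω N lam h) (hg : ‖g‖ = 1) (hΩ : IsCompact Ω) :
    volume.real Ω - ∑ k ∈ Finset.range (numEig Ω), lam k ≤
      volume.real Ω - ∫ z in Ω, smoothed g Ω z := by
  have hN := he.numEig_le hg hΩ
  have h := tail_le_of_antitone (l := fun k : ℕ => if (k : ℕ∞) < N then lam k else 0)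
    (V := volume.real Ω) (Q := ∫ z in Ω, smoothed g Ω z) (A := numEig Ω)
    (fun j k hjk => ?_) (fun k => ?_) (fun k => ?_) (hasSum_extend_zero (he.hasSum_lam hg hΩ)) ?_
    (Nat.le_ceil _)
  · rwa [Finset.sum_congr rfl fun k hk => if_pos
      ((Nat.cast_lt.mpr (Finset.mem_range.mp hk)).trans_le hN)] at h
  · have hjk' : (j : ℕ∞) ≤ k := Nat.cast_le.mpr hjk
    by_cases hk : (k : ℕ∞) < N
    · simp only [hk, hjk'.trans_lt hk, if_true]
      exact he.antitone (hjk'.trans_lt hk) hk hjk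
    · simp only [hk, if_false]
      split_ifs with hj
      · exact he.lam_nonneg hΩ hj
      · exact le_rfl
  · split_ifs with hk
    · exact he.lam_nonneg hΩ hk
    · exact le_rfl
  · split_ifs with hk
    · exact he.lam_le_one hg hΩ hk
    · exact zero_le_one
  · have := hasSum_extend_zero (f := fun k => lam k ^ 2) (he.hasSum_lam_sq hΩ)
    simpa only [ite_pow, ne_eq, OfNat.ofNat_ne_zero, not_false_eq_true, zero_pow] using this

/-- With `1_Ω * |V_g g|² = ∑ lam k |V_g (h k)|²`, the difference has the coefficients `1 - lam k` on
the first `⌈|Ω|⌉` spectrograms and `-lam k` on the others, and each spectrogram has integral `1`. -/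
theorem integral_abs_accSpec_sub_smoothed_le (he : IsEigensystem g Ω N lam h) (hg : ‖g‖ = 1)
    (hΩ : IsCompact Ω) :
    ∫ z, |accSpec g Ω h z - smoothed g Ω z| ≤
      numEig Ω + volume.real Ω - 2 * ∑ k ∈ Finset.range (numEig Ω), lam k := by
  set A := numEig Ω with hA
  have hlt {k : ℕ} (hk : k ∈ Finset.range A) : (k : ℕ∞) < N :=
    (Nat.cast_lt.mpr (Finset.mem_range.mp hk)).trans_le (he.numEig_le hg hΩ)
  let p : ℕ → Phase d → ℝ := fun k z => ‖stft g (h k) z‖ ^ 2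
  have hpi (k) : Integrable (p k) := integrable_norm_stft_sq g (h k)
  have hp1 {k} (hk : k ∈ Finset.range A) : ∫ z, p k z = 1 := by
    simp only [p]
    rw [integral_norm_stft_sq, he.norm_eq_one (hlt hk), hg]
    norm_num
  have hpart (z) : ∑ k ∈ Finset.range A, lam k * p k z ≤ smoothed g Ω z := by
    have h1 := hasSum_extend_zero (f := fun k => lam k * p k z) (he.hasSum_smoothed hΩ z)
    have h2 := sum_le_hasSum (Finset.range A) (fun k _ => ?_) h1
    · rwa [Finset.sum_congr rfl fun k hk => if_pos (hlt hk)] at h2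
    · split_ifs with hk
      · exact mul_nonneg (he.lam_nonneg hΩ hk) (by positivity)
      · exact le_rfl
  have hi1 (c : ℕ → ℝ) : Integrable fun z => ∑ k ∈ Finset.range A, c k * p k z :=
    integrable_finsetSum _ fun k _ => (hpi k).const_mul (c k)
  have hint (c : ℕ → ℝ) : ∫ z, ∑ k ∈ Finset.range A, c k * p k z =
      ∑ k ∈ Finset.range A, c k := by
    rw [integral_finsetSum _ fun k _ => (hpi k).const_mul (c k)]
    refine Finset.sum_congr rfl fun k hk => ?_
    rw [integral_const_mul, hp1 hk, mul_one]
  have hi2 : Integrable fun z => smoothed g Ω z - ∑ k ∈ Finset.range A, lam k * p k z :=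
    (integrable_smoothed g hΩ).sub (hi1 _)
  calc ∫ z, |accSpec g Ω h z - smoothed g Ω z|
      ≤ ∫ z, (∑ k ∈ Finset.range A, (1 - lam k) * p k z +
          (smoothed g Ω z - ∑ k ∈ Finset.range A, lam k * p k z)) := by
        refine integral_mono (integrable_accSpec_sub_smoothed g hΩ h).abs
          ((hi1 _).add hi2) fun z => ?_
        have h1 : 0 ≤ ∑ k ∈ Finset.range A, (1 - lam k) * p k z :=
          Finset.sum_nonneg fun k hk => mul_nonneg
            (sub_nonneg.mpr (he.lam_le_one hg hΩ (hlt hk))) (by positivity)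
        have h2 : accSpec g Ω h z = ∑ k ∈ Finset.range A, (1 - lam k) * p k z +
            ∑ k ∈ Finset.range A, lam k * p k z := by
          rw [← Finset.sum_add_distrib]
          refine Finset.sum_congr rfl fun k _ => ?_
          simp only [p]
          ring
        have h3 := hpart z
        dsimp only
        rw [h2, abs_le]
        constructor <;> linarith
    _ = A + volume.real Ω - 2 * ∑ k ∈ Finset.range A, lam k := by
        rw [integral_add (hi1 _) hi2,
          integral_sub (integrable_smoothed g hΩ) (hi1 _), hint, hint, integral_smoothed g hΩ, hg,
          Finset.sum_sub_distrib]
        simp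
        ring

end IsEigensystem

end AccSpec

theorem theorem1p4 (d : ℕ) (g : AccSpec.L2 d) (hgM : AccSpec.MemMStar g) (hg : ‖g‖ = 1)
    (Ω : Set (AccSpec.Phase d)) (hΩ : IsCompact Ω) (hpos : 0 < volume Ω)
    (hper : AccSpec.perimeter Ω < ∞) :
    (∃ (N : ℕ∞) (lam : ℕ → ℝ) (h : ℕ → AccSpec.L2 d), AccSpec.IsEigensystem g Ω N lam h) ∧
    ∀ (N : ℕ∞) (lam : ℕ → ℝ) (h : ℕ → AccSpec.L2 d), AccSpec.IsEigensystem g Ω N lam h →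
      (AccSpec.numEig Ω : ℕ∞) ≤ N ∧
      Integrable (fun z => AccSpec.accSpec g Ω h z - AccSpec.smoothed g Ω z) ∧
      1 / volume.real Ω * ∫ z, |AccSpec.accSpec g Ω h z - AccSpec.smoothed g Ω z| ≤
        1 / volume.real Ω +
          4 * AccSpec.normMStar g * √((AccSpec.perimeter Ω).toReal / volume.real Ω) := by
  refine ⟨AccSpec.exists_isEigensystem g hΩ, fun N lam h he => ⟨he.numEig_le hg hΩ,
    AccSpec.integrable_accSpec_sub_smoothed g hΩ h, ?_⟩⟩
  have hV : 0 < volume.real Ω := ENNReal.toReal_pos hpos.ne' hΩ.measure_lt_top.ne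
  have hL1 := he.integral_abs_accSpec_sub_smoothed_le hg hΩ
  have htail := (he.tail_le hg hΩ).trans
    (AccSpec.volume_sub_integral_smoothed_le g hgM hg hΩ hper.ne)
  have hA : (AccSpec.numEig Ω : ℝ) < volume.real Ω + 1 := Nat.ceil_lt_add_one hV.le
  have hsum0 : 0 ≤ ∑ k ∈ Finset.range (AccSpec.numEig Ω), lam k :=
    Finset.sum_nonneg fun k hk => he.lam_nonneg hΩ
      ((Nat.cast_lt.mpr (Finset.mem_range.mp hk)).trans_le (he.numEig_le hg hΩ))
  set V := volume.real Ω
  set P := (AccSpec.perimeter Ω).toReal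
  set M := AccSpec.normMStar g
  set S := V - ∑ k ∈ Finset.range (AccSpec.numEig Ω), lam k with hS
  have hP : 0 ≤ P := ENNReal.toReal_nonneg
  have hM : 0 ≤ M := Real.sqrt_nonneg _
  -- The tail `S` is at most `V` and at most `M ^ 2 * P`, hence at most their geometric mean.
  have hSle : S ≤ V * (M * √(P / V)) := by
    rcases le_total S 0 with h0 | h0
    · exact h0.trans (by positivity)
    · refine (pow_le_pow_iff_left₀ h0 (by positivity) two_ne_zero).mp ?_
      rw [mul_pow, mul_pow, Real.sq_sqrt (by positivity)]
      calc S ^ 2 = S * S := sq S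
        _ ≤ V * (M ^ 2 * P) := by gcongr; linarith
        _ = V ^ 2 * (M ^ 2 * (P / V)) := by field_simp
  rw [one_div_mul_eq_div, div_le_iff₀ hV, add_mul, one_div_mul_cancel hV.ne']
  have : 0 ≤ V * (M * √(P / V)) := by positivity
  linarith
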